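/- Let $A$ be a lattice-ordered algebra, i.e. a real vector lattice together with a real (associative, not necessarily unital) algebra structure for which the product of positive elements is positive. Suppose there exist non-zero positive elements $e,p\in A_+$ such that (i) $e^2=e$ and $p^2=p$; (ii) $ep=pe=p$; (iii) $p=\alpha e+x$ for some $x\in A$ with $x\wedge e=0$ and some real number $\alpha\ge 0$. For a Dedekind complete vector lattice $X$, let $\mathcal L^r(X)$ denote the space of regular operators on $X$, that is, of the linear maps $X\to X$ that are differences of two positive linear maps; it is a vector lattice for the order in which $S\le T$ if and only if $Sx\le Tx$ for all $x\ge 0$, and an algebra under composition. If $\alpha\notin\{0\}\cup\{1/n : n\in\mathbb N,\ n\ge 1\}$, then $A$ has no faithful representation on $\mathcal L^r(X)$ for any Dedekind complete vector lattice $X$: there is no injective map $\Phi\colon A\to\mathcal L^r(X)$ that is both a lattice homomorphism and a (not necessarily unital) algebra homomorphism. -/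

import Mathlib

section RegularOperators

variable (X : Type*) [ConditionallyCompleteLattice X] [AddCommGroup X] [IsOrderedAddMonoid X]
  [Module ℝ X] [IsOrderedModule ℝ X]

/-- A linear operator on a vector lattice is positive if it maps positive vectors to positive
vectors. -/
def IsPositiveOperator {X : Type*} [Lattice X] [AddCommGroup X] [Module ℝ X]
    (T : Module.End ℝ X) : Prop :=
  ∀ x : X, 0 ≤ x → 0 ≤ T x

/-- The algebra `L^r(X)` of regular operators, i.e. differences of two positive operators, on a
Dedekind complete vector lattice `X`; the product is composition. -/
def RegularOperator : Subalgebra ℝ (Module.End ℝ X) where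
  carrier := {T | ∃ R S : Module.End ℝ X, IsPositiveOperator R ∧ IsPositiveOperator S ∧ T = R - S}
  mul_mem' := by
    rintro _ _ ⟨R, S, hR, hS, rfl⟩ ⟨R', S', hR', hS', rfl⟩
    refine ⟨R * R' + S * S', R * S' + S * R', fun x hx => ?_, fun x hx => ?_, by noncomm_ring⟩
    · exact add_nonneg (hR _ (hR' _ hx)) (hS _ (hS' _ hx))
    · exact add_nonneg (hR _ (hS' _ hx)) (hS _ (hR' _ hx))
  add_mem' := by
    rintro _ _ ⟨R, S, hR, hS, rfl⟩ ⟨R', S', hR', hS', rfl⟩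
    exact ⟨R + R', S + S', fun x hx => add_nonneg (hR _ hx) (hR' _ hx),
      fun x hx => add_nonneg (hS _ hx) (hS' _ hx), by abel⟩
  algebraMap_mem' := by
    intro r
    refine ⟨algebraMap ℝ _ (max r 0), algebraMap ℝ _ (max (-r) 0), fun x hx => ?_, fun x hx => ?_,
      ?_⟩
    · simpa using smul_nonneg (le_max_right r 0) hx
    · simpa using smul_nonneg (le_max_right (-r) 0) hx
    · rw [← map_sub]
      congr 1
      rcases le_total r 0 with h | h <;> simp [h]

namespace RegularOperator

variable {X}

/-- The operator order: `S ≤ T` if and only if `S x ≤ T x` for all `x ≥ 0`, that is, `T - S` is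
positive. -/
instance : PartialOrder (RegularOperator X) where
  le S T := ∀ x : X, 0 ≤ x → S.1 x ≤ T.1 x
  le_refl S x _ := le_rfl
  le_trans S T U h₁ h₂ x hx := (h₁ x hx).trans (h₂ x hx)
  le_antisymm S T h₁ h₂ := by
    have key : ∀ x : X, 0 ≤ x → S.1 x = T.1 x := fun x hx => le_antisymm (h₁ x hx) (h₂ x hx)
    refine Subtype.ext (LinearMap.ext fun x => ?_)
    rw [← posPart_sub_negPart x, map_sub, map_sub, key _ (posPart_nonneg x),
      key _ (negPart_nonneg x)]

theorem le_iff {S T : RegularOperator X} : S ≤ T ↔ ∀ x : X, 0 ≤ x → S.1 x ≤ T.1 x := Iff.rfl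

theorem bddAbove_image (T : RegularOperator X) (x : X) : BddAbove (T.1 '' Set.Icc 0 x) := by
  obtain ⟨_, R, S, hR, hS, rfl⟩ := T
  refine ⟨R x, ?_⟩
  rintro _ ⟨y, ⟨hy0, hyx⟩, rfl⟩
  have h₁ := hS y hy0
  have h₂ := hR (x - y) (sub_nonneg.2 hyx)
  rw [map_sub, sub_nonneg] at h₂
  simpa using (sub_le_self (R y) h₁).trans h₂

/-- The Riesz–Kantorovich formula for the positive part of `T`, at a positive vector `x`. -/
noncomputable def posAux (T : RegularOperator X) (x : X) : X := sSup (T.1 '' Set.Icc 0 x)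

theorem le_posAux (T : RegularOperator X) {x y : X} (hy : 0 ≤ y) (hyx : y ≤ x) :
    T.1 y ≤ posAux T x :=
  le_csSup (bddAbove_image T x) ⟨y, ⟨hy, hyx⟩, rfl⟩

theorem posAux_le (T : RegularOperator X) {x b : X} (hx : 0 ≤ x)
    (h : ∀ y, 0 ≤ y → y ≤ x → T.1 y ≤ b) : posAux T x ≤ b := by
  refine csSup_le ⟨_, 0, ⟨le_rfl, hx⟩, rfl⟩ ?_
  rintro _ ⟨y, ⟨h₀, h₁⟩, rfl⟩
  exact h y h₀ h₁

theorem posAux_nonneg (T : RegularOperator X) {x : X} (hx : 0 ≤ x) : 0 ≤ posAux T x := by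
  simpa using le_posAux T le_rfl hx

theorem posAux_add (T : RegularOperator X) {x y : X} (hx : 0 ≤ x) (hy : 0 ≤ y) :
    posAux T (x + y) = posAux T x + posAux T y := by
  apply le_antisymm
  · refine posAux_le T (add_nonneg hx hy) fun z hz hzxy => ?_
    have h₁ : T.1 (z ⊓ x) ≤ posAux T x := le_posAux T (le_inf hz hx) inf_le_right
    have h₂ : T.1 (z - z ⊓ x) ≤ posAux T y := by
      refine le_posAux T (sub_nonneg.2 inf_le_left) ?_
      rw [sub_le_iff_le_add, ← sub_le_iff_le_add']
      exact le_inf (sub_le_self _ hy) (sub_le_iff_le_add.2 hzxy)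
    have h₃ := add_le_add h₁ h₂
    rwa [← map_add, add_sub_cancel] at h₃
  · rw [← le_sub_iff_add_le]
    refine posAux_le T hx fun a ha hax => ?_
    rw [le_sub_iff_add_le, ← le_sub_iff_add_le']
    refine posAux_le T hy fun b hb hby => ?_
    rw [le_sub_iff_add_le', ← map_add]
    exact le_posAux T (add_nonneg ha hb) (add_le_add hax hby)

theorem posAux_smul_le (T : RegularOperator X) {c : ℝ} (hc : 0 < c) {x : X} (hx : 0 ≤ x) :
    posAux T (c • x) ≤ c • posAux T x := by
  refine posAux_le T (smul_nonneg hc.le hx) fun y hy hyx => ?_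
  have h := le_posAux T (x := x) (smul_nonneg (inv_pos.2 hc).le hy) (by
    have h := smul_le_smul_of_nonneg_left hyx (inv_pos.2 hc).le
    rwa [inv_smul_smul₀ hc.ne'] at h)
  have h' := smul_le_smul_of_nonneg_left h hc.le
  rwa [map_smul, smul_inv_smul₀ hc.ne'] at h'

theorem posAux_smul (T : RegularOperator X) {c : ℝ} (hc : 0 < c) {x : X} (hx : 0 ≤ x) :
    posAux T (c • x) = c • posAux T x := by
  refine le_antisymm (posAux_smul_le T hc hx) ?_
  have h := smul_le_smul_of_nonneg_left
    (posAux_smul_le T (inv_pos.2 hc) (smul_nonneg hc.le hx)) hc.le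
  rwa [inv_smul_smul₀ hc.ne', smul_inv_smul₀ hc.ne'] at h

theorem posAux_ext (T : RegularOperator X) {x a b : X} (ha : 0 ≤ a) (hb : 0 ≤ b)
    (h : x = a - b) : posAux T x⁺ - posAux T x⁻ = posAux T a - posAux T b := by
  rw [sub_eq_sub_iff_add_eq_add, ← posAux_add T (posPart_nonneg x) hb,
    ← posAux_add T ha (negPart_nonneg x)]
  congr 1
  rw [← sub_eq_sub_iff_add_eq_add, posPart_sub_negPart, h]

/-- The positive part of `T` as a linear operator. -/
noncomputable def posLin (T : RegularOperator X) : Module.End ℝ X where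
  toFun x := posAux T x⁺ - posAux T x⁻
  map_add' x y := by
    rw [posAux_ext T (add_nonneg (posPart_nonneg x) (posPart_nonneg y))
      (add_nonneg (negPart_nonneg x) (negPart_nonneg y)) (x := x + y)
      (by rw [add_sub_add_comm, posPart_sub_negPart, posPart_sub_negPart]),
      posAux_add T (posPart_nonneg x) (posPart_nonneg y),
      posAux_add T (negPart_nonneg x) (negPart_nonneg y), add_sub_add_comm]
  map_smul' c x := by
    have hp := posPart_nonneg x
    have hn := negPart_nonneg x
    rw [RingHom.id_apply]
    rcases lt_trichotomy c 0 with hc | rfl | hc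
    · have hc' : 0 < -c := neg_pos.2 hc
      rw [posAux_ext T (smul_nonneg hc'.le hn) (smul_nonneg hc'.le hp) (x := c • x) (by
        rw [← smul_sub, neg_smul, ← smul_neg, neg_sub, posPart_sub_negPart]),
        posAux_smul T hc' hn, posAux_smul T hc' hp, ← smul_sub, neg_smul, ← smul_neg, neg_sub]
    · simp
    · rw [posAux_ext T (smul_nonneg hc.le hp) (smul_nonneg hc.le hn) (x := c • x) (by
        rw [← smul_sub, posPart_sub_negPart]),
        posAux_smul T hc hp, posAux_smul T hc hn, smul_sub]

theorem posLin_apply (T : RegularOperator X) {x : X} (hx : 0 ≤ x) :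
    posLin T x = sSup (T.1 '' Set.Icc 0 x) := by
  change posAux T x⁺ - posAux T x⁻ = posAux T x
  rw [posAux_ext T hx le_rfl (sub_zero x).symm, sub_eq_self]
  refine le_antisymm (posAux_le T le_rfl fun y hy hy0 => ?_) (posAux_nonneg T le_rfl)
  rw [le_antisymm hy0 hy, map_zero]

/-- The positive part of `T` as a regular operator. -/
noncomputable def pos (T : RegularOperator X) : RegularOperator X :=
  ⟨posLin T, posLin T, 0, fun x hx => by rw [posLin_apply T hx]; exact posAux_nonneg T hx,
    fun _ _ => le_rfl, (sub_zero _).symm⟩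

theorem pos_apply (T : RegularOperator X) {x : X} (hx : 0 ≤ x) :
    (pos T).1 x = sSup (T.1 '' Set.Icc 0 x) := posLin_apply T hx

theorem isLUB_pos (T : RegularOperator X) : IsLUB {T, 0} (pos T) := by
  refine ⟨?_, fun U hU x hx => ?_⟩
  · rintro S (rfl | rfl) x hx
    · rw [pos_apply _ hx]
      exact le_posAux _ hx le_rfl
    · rw [pos_apply _ hx]
      exact posAux_nonneg T hx
  · have hT : T ≤ U := hU (Or.inl rfl)
    have h0 : (0 : RegularOperator X) ≤ U := hU (Or.inr rfl)
    rw [pos_apply T hx]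
    refine posAux_le T hx fun y hy hyx => (hT y hy).trans ?_
    have h : 0 ≤ U.1 (x - y) := h0 (x - y) (sub_nonneg.2 hyx)
    rw [map_sub] at h
    exact sub_nonneg.1 h

instance : IsOrderedAddMonoid (RegularOperator X) where
  add_le_add_left _ _ h U x hx := add_le_add_left (h x hx) (U.1 x)

instance : IsOrderedModule ℝ (RegularOperator X) where
  smul_le_smul_of_nonneg_left _ hc _ _ h x hx := smul_le_smul_of_nonneg_left (h x hx) hc
  smul_le_smul_of_nonneg_right _ hT _ _ h x hx := smul_le_smul_of_nonneg_right h (hT x hx)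

/-- `L^r(X)` is a lattice for the operator order, with `S ⊔ T = T + (S - T)⁺` and
`S ⊓ T = S - (S - T)⁺`. -/
noncomputable instance : Lattice (RegularOperator X) where
  sup S T := T + pos (S - T)
  inf S T := S - pos (S - T)
  le_sup_left S T := sub_le_iff_le_add'.1 ((isLUB_pos (S - T)).1 (Or.inl rfl))
  le_sup_right S T := le_add_of_nonneg_right ((isLUB_pos (S - T)).1 (Or.inr rfl))
  sup_le S T U h₁ h₂ := by
    rw [← le_sub_iff_add_le']
    refine (isLUB_pos (S - T)).2 ?_
    rintro V (rfl | rfl)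
    · exact sub_le_sub_right h₁ T
    · exact sub_nonneg.2 h₂
  inf_le_left S T := sub_le_self _ ((isLUB_pos (S - T)).1 (Or.inr rfl))
  inf_le_right S T := sub_le_comm.1 ((isLUB_pos (S - T)).1 (Or.inl rfl))
  le_inf U S T h₁ h₂ := by
    rw [le_sub_comm]
    refine (isLUB_pos (S - T)).2 ?_
    rintro V (rfl | rfl)
    · exact sub_le_sub_left h₂ S
    · exact sub_nonneg.2 h₁

end RegularOperator

end RegularOperators

/-! On the fixed space of `Φ e`, a Dedekind complete vector lattice, `Φ p` acts as a positive
projection `P` with `α • z ≤ P z` for `z ≥ 0`, and `P - α` is disjoint from the identity. Such a `P`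
resembles a conditional expectation whose fibres consist of atoms of weight `α`; a fibre has total
weight 1, so `1 / α` must be an integer.

To avoid atoms, fix `u = P u > 0` and cut disjoint components `c` off `u` with `α u ≤ P c ≤ β u`,
for `β` slightly above `α`, locally on smaller and smaller fixed elements `w`
(`exists_component_map_between`). "On `w`" means that `w` is disjoint from the positive part of the
difference. If `n α < 1 < (n + 1) α`, choose `β` with `n β < 1`: after `n` cuts something is left,
and one more cut gives total mass at least `(n + 1) α u > u` on `w`, which is impossible. The
localisation survives `P` because `P` preserves disjointness from fixed elements
(`map_inf_eq_zero`). -/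

section VectorLattice

/-! ### Disjointness and components in lattice-ordered groups. -/

theorem inf_add_le_inf_add_inf {G : Type*} [Lattice G] [AddCommGroup G] [IsOrderedAddMonoid G]
    {x y z : G} (hx : 0 ≤ x) (hy : 0 ≤ y) (hz : 0 ≤ z) : x ⊓ (y + z) ≤ x ⊓ y + x ⊓ z := by
  rw [← sub_le_iff_le_add]
  refine le_inf ?_ ?_
  · exact (sub_le_self _ (le_inf hx hz)).trans inf_le_left
  · rw [sub_le_iff_le_add, ← sub_le_iff_le_add']
    refine le_inf ?_ ?_
    · exact (sub_le_self _ hy).trans inf_le_left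
    · rw [sub_le_iff_le_add']
      exact inf_le_right

theorem inf_add_eq_zero {G : Type*} [Lattice G] [AddCommGroup G] [IsOrderedAddMonoid G]
    {x y z : G} (hx : 0 ≤ x) (hy : 0 ≤ y) (hz : 0 ≤ z) (hxy : x ⊓ y = 0) (hxz : x ⊓ z = 0) :
    x ⊓ (y + z) = 0 :=
  le_antisymm ((inf_add_le_inf_add_inf hx hy hz).trans (by rw [hxy, hxz, add_zero]))
    (le_inf hx (add_nonneg hy hz))

theorem inf_eq_zero_of_le {G : Type*} [Lattice G] [AddCommGroup G]
    {x y x' y' : G} (hx' : 0 ≤ x') (hy' : 0 ≤ y') (hx : x' ≤ x) (hy : y' ≤ y) (h : x ⊓ y = 0) :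
    x' ⊓ y' = 0 :=
  le_antisymm ((inf_le_inf hx hy).trans h.le) (le_inf hx' hy')

theorem le_of_le_add_of_inf_eq_zero {G : Type*} [Lattice G] [AddCommGroup G]
    [IsOrderedAddMonoid G] {x y z : G} (hx : 0 ≤ x) (hy : 0 ≤ y) (hz : 0 ≤ z) (h : x ≤ y + z)
    (hxz : x ⊓ z = 0) : x ≤ y := by
  have h₁ := (le_inf le_rfl h).trans (inf_add_le_inf_add_inf hx hy hz)
  rw [hxz, add_zero] at h₁
  exact h₁.trans inf_le_right

theorem inf_nsmul_eq_zero {G : Type*} [Lattice G] [AddCommGroup G] [IsOrderedAddMonoid G]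
    {x y : G} (hx : 0 ≤ x) (hy : 0 ≤ y) (h : x ⊓ y = 0) (n : ℕ) : x ⊓ n • y = 0 := by
  induction n with
  | zero => simpa using hx
  | succ n ih =>
    rw [succ_nsmul]
    exact inf_add_eq_zero hx (nsmul_nonneg hy n) hy ih h

theorem inf_smul_eq_zero {V : Type*} [Lattice V] [AddCommGroup V] [IsOrderedAddMonoid V]
    [Module ℝ V] [IsOrderedModule ℝ V] {x y : V} (hx : 0 ≤ x) (hy : 0 ≤ y) (h : x ⊓ y = 0)
    {c : ℝ} (hc : 0 ≤ c) : x ⊓ c • y = 0 := by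
  obtain ⟨n, hn⟩ := exists_nat_ge c
  refine inf_eq_zero_of_le hx (smul_nonneg hc hy) le_rfl ?_ (inf_nsmul_eq_zero hx hy h n)
  rw [← Nat.cast_smul_eq_nsmul ℝ]
  exact smul_le_smul_of_nonneg_right hn hy

theorem posPart_le_posPart_add_posPart {G : Type*} [Lattice G] [AddCommGroup G]
    [IsOrderedAddMonoid G] {x y z : G} (h : x ≤ y + z) : x⁺ ≤ y⁺ + z⁺ :=
  sup_le (h.trans (add_le_add (le_posPart _) (le_posPart _)))
    (add_nonneg (posPart_nonneg y) (posPart_nonneg z))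

/-- A conditionally complete lattice-ordered group is Archimedean. -/
theorem le_zero_of_forall_nsmul_le {G : Type*} [ConditionallyCompleteLattice G] [AddCommGroup G]
    [IsOrderedAddMonoid G] {f v : G} (h : ∀ n : ℕ, n • f ≤ v) : f ≤ 0 := by
  have hb : BddAbove (Set.range fun n : ℕ => n • f) := ⟨v, by rintro _ ⟨n, rfl⟩; exact h n⟩
  have h₁ : sSup (Set.range fun n : ℕ => n • f) ≤ sSup (Set.range fun n : ℕ => n • f) - f := by
    refine csSup_le ⟨_, 0, rfl⟩ ?_
    rintro _ ⟨n, rfl⟩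
    rw [le_sub_iff_add_le]
    exact le_csSup hb ⟨n + 1, succ_nsmul f n⟩
  simpa using h₁

/-- In a conditionally complete lattice-ordered group, `c` is the component of `r` in the band
generated by `g`. -/
theorem exists_component {G : Type*} [ConditionallyCompleteLattice G] [AddCommGroup G]
    [IsOrderedAddMonoid G] {r g : G} (hr : 0 ≤ r) (hg : 0 ≤ g) :
    ∃ c, 0 ≤ c ∧ c ≤ r ∧ c ⊓ (r - c) = 0 ∧ (r - c) ⊓ g = 0 ∧
      ∀ h, 0 ≤ h → h ⊓ g = 0 → h ⊓ c = 0 := by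
  set S : Set G := {v | 0 ≤ v ∧ v ≤ r ∧ v ⊓ g = 0} with hS
  have h0 : (0 : G) ∈ S := ⟨le_rfl, hr, by simpa using hg⟩
  have hb : BddAbove S := ⟨r, fun v hv => hv.2.1⟩
  have hq0 : 0 ≤ sSup S := le_csSup hb h0
  have hqr : sSup S ≤ r := csSup_le ⟨0, h0⟩ fun v hv => hv.2.1
  have hqg : sSup S ⊓ g = 0 := by
    refine le_antisymm ?_ (le_inf hq0 hg)
    -- Each `v` in `S` is disjoint from `sSup S ⊓ g`, so their sum is their supremum, which is at
    -- most `sSup S`.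
    have : sSup S ≤ sSup S - sSup S ⊓ g := by
      refine csSup_le ⟨0, h0⟩ fun v hv => ?_
      rw [le_sub_iff_add_le]
      have h₁ : v ⊓ (sSup S ⊓ g) = 0 :=
        inf_eq_zero_of_le hv.1 (le_inf hq0 hg) le_rfl inf_le_right hv.2.2
      have h₂ := inf_add_sup v (sSup S ⊓ g)
      rw [h₁, zero_add] at h₂
      rw [← h₂]
      exact sup_le (le_csSup hb hv) inf_le_left
    simpa using this
  have key : ∀ h, 0 ≤ h → h ⊓ g = 0 → h ⊓ (r - sSup S) = 0 := by
    intro h hh hhg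
    have hd : 0 ≤ h ⊓ (r - sSup S) := le_inf hh (sub_nonneg.2 hqr)
    refine le_antisymm ?_ hd
    have : h ⊓ (r - sSup S) + sSup S ∈ S := by
      refine ⟨add_nonneg hd hq0, ?_, ?_⟩
      · rw [← le_sub_iff_add_le]
        exact inf_le_right
      · rw [inf_comm]
        refine inf_add_eq_zero hg hd hq0 ?_ (by rwa [inf_comm])
        exact inf_eq_zero_of_le hg hd le_rfl inf_le_left (by rwa [inf_comm])
    simpa using le_csSup hb this
  refine ⟨r - sSup S, sub_nonneg.2 hqr, sub_le_self _ hq0, ?_, ?_, key⟩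
  · rw [sub_sub_cancel, inf_comm]
    exact key _ hq0 hqg
  · rwa [sub_sub_cancel]

end VectorLattice

/-! ### Positive projections dominating a positive multiple of the identity. -/

section PositiveProjection

variable {Z : Type*} [ConditionallyCompleteLattice Z] [AddCommGroup Z] [IsOrderedAddMonoid Z]
  [Module ℝ Z] [IsOrderedModule ℝ Z] {P : Module.End ℝ Z} {α : ℝ}

omit [IsOrderedModule ℝ Z] in
theorem IsPositiveOperator.mono (hP : IsPositiveOperator P) {x y : Z} (h : x ≤ y) :
    P x ≤ P y := by
  have := hP (y - x) (sub_nonneg.2 h)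
  rwa [map_sub, sub_nonneg] at this

-- Strict positivity of `P`. It turns one-sided comparisons of `z` with `P z` into equalities, since
-- an idempotent `P` kills the difference.
omit [IsOrderedAddMonoid Z] in
theorem eq_zero_of_smul_le_map (hα : 0 < α) (hle : ∀ z, 0 ≤ z → α • z ≤ P z) {z : Z}
    (hz : 0 ≤ z) (h : P z = 0) : z = 0 := by
  have h₁ := hle z hz
  rw [h] at h₁
  have h₂ := smul_le_smul_of_nonneg_left h₁ (inv_pos.2 hα).le
  rw [inv_smul_smul₀ hα.ne', smul_zero] at h₂
  exact le_antisymm h₂ hz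

/-- The range of a strictly positive projection is closed under positive parts. -/
theorem map_posPart_of_map_eq (hP : IsPositiveOperator P) (hPP : ∀ z, P (P z) = P z)
    (hα : 0 < α) (hle : ∀ z, 0 ≤ z → α • z ≤ P z) {f : Z} (hf : P f = f) : P f⁺ = f⁺ := by
  have h₁ : f⁺ ≤ P f⁺ :=
    sup_le (hf.symm.le.trans (hP.mono (le_posPart _))) (hP _ (posPart_nonneg f))
  refine sub_eq_zero.1 (eq_zero_of_smul_le_map hα hle (sub_nonneg.2 h₁) ?_)
  rw [map_sub, hPP, sub_self]

theorem map_inf_of_map_eq (hP : IsPositiveOperator P) (hPP : ∀ z, P (P z) = P z)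
    (hα : 0 < α) (hle : ∀ z, 0 ≤ z → α • z ≤ P z) {f g : Z} (hf : P f = f) (hg : P g = g) :
    P (f ⊓ g) = f ⊓ g := by
  have h₁ : P (f ⊓ g) ≤ f ⊓ g :=
    le_inf ((hP.mono inf_le_left).trans hf.le) ((hP.mono inf_le_right).trans hg.le)
  refine (sub_eq_zero.1 (eq_zero_of_smul_le_map hα hle (sub_nonneg.2 h₁) ?_)).symm
  rw [map_sub, hPP, sub_self]

/-- A strictly positive projection preserves disjointness from elements of its range. -/
theorem map_inf_eq_zero (hP : IsPositiveOperator P) (hPP : ∀ z, P (P z) = P z)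
    (hα : 0 < α) (hle : ∀ z, 0 ≤ z → α • z ≤ P z) {w g : Z} (hw : 0 ≤ w) (hg0 : 0 ≤ g)
    (hg : P g = g) (h : w ⊓ g = 0) : P w ⊓ g = 0 := by
  have hv := hP w hw
  set v := P w with hvdef
  set f := v ⊓ g with hfdef
  have hf0 : 0 ≤ f := le_inf hv hg0
  have hPf : P f = f := map_inf_of_map_eq hP hPP hα hle (hPP w) hg
  have hwf : w ⊓ f = 0 := inf_eq_zero_of_le hw hf0 le_rfl inf_le_right h
  -- By the Archimedean property it suffices that `n • f ≤ v` for all `n`. As `w` is disjoint from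
  -- `f`, subtracting `n • f` from `v` leaves the bound `α • w` intact; applying `P` turns it into
  -- `α • v ≤ (v - n • f)⁺`. So `(v - n • f)⁻`, which is at most `n • f`, is disjoint from `f` and
  -- vanishes.
  refine le_antisymm (le_zero_of_forall_nsmul_le (v := v) fun n => ?_) hf0
  have hnf : 0 ≤ n • f := nsmul_nonneg hf0 n
  have h₁ : α • w ≤ (v - n • f)⁺ := by
    refine le_of_le_add_of_inf_eq_zero (smul_nonneg hα.le hw) (posPart_nonneg _) hnf ?_ ?_
    · refine (hle w hw).trans ?_
      rw [← sub_le_iff_le_add]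
      exact le_posPart _
    · rw [inf_comm]
      refine inf_smul_eq_zero hnf hw ?_ hα.le
      rw [inf_comm]
      exact inf_nsmul_eq_zero hw hf0 hwf n
  have hPn : P (v - n • f) = v - n • f := by rw [map_sub, map_nsmul, hPf, hvdef, hPP]
  have h₂ : α • v ≤ (v - n • f)⁺ := by
    have := hP.mono h₁
    rwa [map_smul, map_posPart_of_map_eq hP hPP hα hle hPn] at this
  have h₃ : f ⊓ (v - n • f)⁻ = 0 := by
    have h₄ : (v - n • f)⁻ ⊓ α • f = 0 := by
      refine inf_eq_zero_of_le (negPart_nonneg _) (smul_nonneg hα.le hf0) le_rfl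
        ((smul_le_smul_of_nonneg_left inf_le_left hα.le).trans h₂) ?_
      rw [inf_comm]
      exact posPart_inf_negPart_eq_zero _
    have h₅ := inf_smul_eq_zero (negPart_nonneg _) (smul_nonneg hα.le hf0) h₄ (inv_pos.2 hα).le
    rwa [inv_smul_smul₀ hα.ne', inf_comm] at h₅
  have h₆ : (v - n • f)⁻ ≤ n • f := by
    rw [negPart_def]
    refine sup_le ?_ hnf
    rw [neg_sub]
    exact sub_le_self _ hv
  have h₇ : (v - n • f)⁻ ⊓ n • f = 0 :=
    inf_nsmul_eq_zero (negPart_nonneg _) hf0 (by rwa [inf_comm]) n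
  rw [inf_eq_left.2 h₆, negPart_eq_zero, sub_nonneg] at h₇
  exact h₇

/-- One step of the splitting procedure: from a component `r` of `u` that does not vanish on `w`,
split off a component `c` whose image is between `α u` and `β u` on some smaller `w'`. -/
theorem exists_component_map_between (hP : IsPositiveOperator P) (hPP : ∀ z, P (P z) = P z)
    (hα : 0 < α) (hle : ∀ z, 0 ≤ z → α • z ≤ P z)
    (hinf : ∀ z, 0 ≤ z → ∀ w, (∀ a b, 0 ≤ a → 0 ≤ b → a + b = z → w ≤ P a - α • a + b) → w ≤ 0)
    {β : ℝ} (hβ : α < β) {u r w : Z} (hPu : P u = u) (hr : 0 ≤ r) (hru : r ≤ u)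
    (hrc : r ⊓ (u - r) = 0) (hw : 0 ≤ w) (hPw : P w = w) (hrw : r ⊓ w ≠ 0) :
    ∃ c w', 0 ≤ c ∧ c ≤ r ∧ c ⊓ (r - c) = 0 ∧ 0 ≤ w' ∧ w' ≤ w ∧ w' ≠ 0 ∧ P w' = w' ∧
      w' ⊓ (α • u - P c)⁺ = 0 ∧ w' ⊓ (P c - β • u)⁺ = 0 := by
  have hβ1 : 0 < 1 + β := by linarith
  -- The last equation makes `P a ≤ (α + δ) u` and `(1 - δ) c ≤ a` combine to `P c ≤ β u`.
  obtain ⟨δ, hδ0, hδ1, hδ⟩ : ∃ δ : ℝ, 0 < δ ∧ δ < 1 ∧ α + δ = (1 - δ) * β := by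
    refine ⟨(β - α) / (1 + β), div_pos (by linarith) hβ1, ?_, ?_⟩
    · rw [div_lt_one hβ1]
      linarith
    · field_simp
      ring
  have hu : 0 ≤ u := hr.trans hru
  have hz : 0 ≤ r ⊓ w := le_inf hr hw
  set z := r ⊓ w with hzdef
  -- Otherwise `δ • z` would be a lower bound in the Riesz–Kantorovich formula `hinf`, forcing `z =
  -- 0`.
  obtain ⟨a, b, ha, hb, hab, hy⟩ : ∃ a b, 0 ≤ a ∧ 0 ≤ b ∧ a + b = r ∧
      (δ • z - (P a - α • a + b))⁺ ≠ 0 := by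
    by_contra! hcon
    have h₁ := hinf r hr (δ • z) fun a b ha hb hab => by
      have := hcon a b ha hb hab
      rwa [posPart_eq_zero, sub_nonpos] at this
    have h₂ := smul_le_smul_of_nonneg_left h₁ (inv_pos.2 hδ0).le
    rw [inv_smul_smul₀ hδ0.ne', smul_zero] at h₂
    exact hrw (le_antisymm h₂ hz)
  have hPa : 0 ≤ P a - α • a := sub_nonneg.2 (hle a ha)
  have har : a ≤ r := hab ▸ le_add_of_nonneg_right hb
  set y := (δ • z - (P a - α • a + b))⁺ with hydef
  have hy0 : 0 ≤ y := posPart_nonneg _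
  have hyz : y ≤ δ • z := sup_le (sub_le_self _ (add_nonneg hPa hb)) (smul_nonneg hδ0.le hz)
  -- On `c` one has `b ≤ δ r`, so `a = r - b` is at least `(1 - δ) c`. Also `y ≤ (δ • r - b)⁺`, so
  -- `u` and `c` agree on `y`.
  obtain ⟨c, hc, hcr, hcc, hcg, hcd⟩ := exists_component hr (posPart_nonneg (δ • r - b))
  have hyg : y ≤ (δ • r - b)⁺ := by
    refine sup_le (le_trans ?_ (le_posPart _)) (posPart_nonneg _)
    exact sub_le_sub (smul_le_smul_of_nonneg_left inf_le_left hδ0.le)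
      (le_add_of_nonneg_left hPa)
  have hyr : y ⊓ (r - c) = 0 := by
    rw [inf_comm]
    exact inf_eq_zero_of_le (sub_nonneg.2 hcr) hy0 le_rfl hyg hcg
  have hyu : y ⊓ (u - r) = 0 := by
    rw [inf_comm]
    have := inf_smul_eq_zero (sub_nonneg.2 hru) hr (by rwa [inf_comm]) hδ0.le
    exact inf_eq_zero_of_le (sub_nonneg.2 hru) hy0 le_rfl
      (hyz.trans (smul_le_smul_of_nonneg_left inf_le_left hδ0.le)) this
  have hyuc : y ⊓ (u - c) = 0 := by
    have := inf_add_eq_zero hy0 (sub_nonneg.2 hru) (sub_nonneg.2 hcr) hyu hyr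
    rwa [sub_add_sub_cancel] at this
  have hlow : y ⊓ (α • u - P c)⁺ = 0 := by
    refine inf_eq_zero_of_le hy0 (posPart_nonneg _) le_rfl ?_
      (inf_smul_eq_zero hy0 (sub_nonneg.2 (hcr.trans hru)) hyuc hα.le)
    refine sup_le ?_ (smul_nonneg hα.le (sub_nonneg.2 (hcr.trans hru)))
    rw [smul_sub]
    exact sub_le_sub_left (hle c hc) _
  have hca : (1 - δ) • c ≤ a := by
    have hn : (δ • r - b)⁻ ⊓ c = 0 := by
      refine hcd _ (negPart_nonneg _) ?_
      rw [inf_comm]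
      exact posPart_inf_negPart_eq_zero _
    have h1δ : 0 ≤ 1 - δ := by linarith
    refine le_of_le_add_of_inf_eq_zero (smul_nonneg h1δ hc) ha (negPart_nonneg (δ • r - b)) ?_ ?_
    · refine (smul_le_smul_of_nonneg_left hcr h1δ).trans ?_
      rw [← sub_le_iff_le_add']
      refine le_trans (le_of_eq ?_) (neg_le_negPart (δ • r - b))
      rw [← hab]
      module
    · rw [inf_comm]
      exact inf_smul_eq_zero (negPart_nonneg _) hc hn h1δ
  have hupa : y ⊓ (P a - (α + δ) • u)⁺ = 0 := by
    refine inf_eq_zero_of_le hy0 (posPart_nonneg _) le_rfl ?_ (posPart_inf_negPart_eq_zero _)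
    rw [negPart_def, posPart_def]
    refine sup_le_sup_right ?_ 0
    rw [neg_sub]
    have h₁ : α • a ≤ α • u := smul_le_smul_of_nonneg_left (har.trans hru) hα.le
    have h₂ : δ • z ≤ δ • u := smul_le_smul_of_nonneg_left (inf_le_left.trans hru) hδ0.le
    have h₃ := add_le_add (add_le_add h₁ h₂) hb
    rw [add_zero] at h₃
    rw [← sub_nonneg] at h₃ ⊢
    refine h₃.trans (le_of_eq ?_)
    module
  have hup : y ⊓ (P c - β • u)⁺ = 0 := by
    have h1δ : 0 < 1 - δ := by linarith
    refine inf_eq_zero_of_le hy0 (posPart_nonneg _) le_rfl ?_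
      (inf_smul_eq_zero hy0 (posPart_nonneg _) hupa (inv_pos.2 h1δ).le)
    refine sup_le ?_ (smul_nonneg (inv_pos.2 h1δ).le (posPart_nonneg _))
    refine le_trans ?_ (smul_le_smul_of_nonneg_left (le_posPart _) (inv_pos.2 h1δ).le)
    have h₁ := hP.mono hca
    rw [map_smul] at h₁
    have h₂ := smul_le_smul_of_nonneg_left (sub_le_sub_right h₁ ((α + δ) • u))
      (inv_pos.2 h1δ).le
    refine le_trans (le_of_eq ?_) h₂
    rw [hδ, mul_smul, ← smul_sub, inv_smul_smul₀ h1δ.ne']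
  have hPPa : ∀ s : ℝ, ∀ x : Z, P (s • u - P x)⁺ = (s • u - P x)⁺ := fun s x =>
    map_posPart_of_map_eq hP hPP hα hle (by rw [map_sub, map_smul, hPu, hPP])
  -- Both bounds hold on `y`; passing to `P y` makes the witness fixed by `P`, as the next cut
  -- requires.
  refine ⟨c, P y, hc, hcr, hcc, hP y hy0, ?_, fun h => hy (eq_zero_of_smul_le_map hα hle hy0 h),
    hPP y, ?_, ?_⟩
  · refine (hP.mono (hyz.trans ?_)).trans hPw.le
    exact (smul_le_of_le_one_left hz hδ1.le).trans inf_le_right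
  · exact map_inf_eq_zero hP hPP hα hle hy0 (posPart_nonneg _) (hPPa _ _) hlow
  · refine map_inf_eq_zero hP hPP hα hle hy0 (posPart_nonneg _) ?_ hup
    exact map_posPart_of_map_eq hP hPP hα hle (by rw [map_sub, map_smul, hPu, hPP])

/-- Here `r` is what remains of `u` after `k` cuts, and the last two conditions say `k α u ≤ P (u -
r) ≤ k β u` on `w`. -/
theorem exists_component_map_between_nat (hP : IsPositiveOperator P) (hPP : ∀ z, P (P z) = P z)
    (hα : 0 < α) (hle : ∀ z, 0 ≤ z → α • z ≤ P z)
    (hinf : ∀ z, 0 ≤ z → ∀ w, (∀ a b, 0 ≤ a → 0 ≤ b → a + b = z → w ≤ P a - α • a + b) → w ≤ 0)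
    {β : ℝ} (hβ : α < β) {u : Z} (hPu : P u = u) (hu : 0 ≤ u) (hu0 : u ≠ 0) {n : ℕ}
    (hn : n * β < 1) (k : ℕ) (hk : k ≤ n + 1) :
    ∃ r w, 0 ≤ r ∧ r ≤ u ∧ r ⊓ (u - r) = 0 ∧ 0 ≤ w ∧ w ≤ u ∧ w ≠ 0 ∧ P w = w ∧
      w ⊓ ((k * α) • u - P (u - r))⁺ = 0 ∧ w ⊓ (P (u - r) - (k * β) • u)⁺ = 0 := by
  induction k with
  | zero => exact ⟨u, u, hu, le_rfl, by simpa using hu, hu, le_rfl, hu0, hPu, by simpa using hu,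
      by simpa using hu⟩
  | succ k ih =>
    obtain ⟨r, w, hr, hru, hrc, hw, hwu, hw0, hPw, hlow, hup⟩ := ih (by omega)
    have hkβ : 0 < 1 - k * β := by
      have : (k : ℝ) ≤ n := by exact_mod_cast (by omega : k ≤ n)
      nlinarith
    -- If `r` missed `w`, so would `P r`; but on `w` the upper bound gives `P r ≥ (1 - k β) u`, with
    -- `k β < 1` because `k ≤ n`.
    have hrw : r ⊓ w ≠ 0 := by
      intro h
      have h₁ : w ⊓ P r = 0 := by
        rw [inf_comm]
        exact map_inf_eq_zero hP hPP hα hle hr hw hPw h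
      have h₂ := inf_add_eq_zero hw (hP r hr) (posPart_nonneg _) h₁ hup
      have h₃ : w ⊓ (1 - k * β) • u = 0 := by
        refine inf_eq_zero_of_le hw (smul_nonneg hkβ.le hu) le_rfl ?_ h₂
        rw [← sub_le_iff_le_add']
        refine le_trans (le_of_eq ?_) (le_posPart _)
        rw [map_sub, hPu]
        module
      have h₄ := inf_smul_eq_zero hw (smul_nonneg hkβ.le hu) h₃ (inv_pos.2 hkβ).le
      rw [inv_smul_smul₀ hkβ.ne', inf_eq_left.2 hwu] at h₄
      exact hw0 h₄
    obtain ⟨c, w', hc, hcr, hcc, hw', hww, hw0', hPw', hlow', hup'⟩ :=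
      exists_component_map_between hP hPP hα hle hinf hβ hPu hr hru hrc hw hPw hrw
    refine ⟨r - c, w', sub_nonneg.2 hcr, (sub_le_self _ hc).trans hru, ?_, hw', hww.trans hwu,
      hw0', hPw', ?_, ?_⟩
    · have h₁ : (r - c) ⊓ (u - r) = 0 :=
        inf_eq_zero_of_le (sub_nonneg.2 hcr) (sub_nonneg.2 hru) (sub_le_self _ hc) le_rfl hrc
      have h₂ := inf_add_eq_zero (sub_nonneg.2 hcr) (sub_nonneg.2 hru) hc h₁
        (by rwa [inf_comm])
      rwa [show u - r + c = u - (r - c) by abel] at h₂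
    · have h₁ := inf_eq_zero_of_le hw' (posPart_nonneg _) hww le_rfl hlow
      refine inf_eq_zero_of_le hw' (posPart_nonneg _) le_rfl
        (posPart_le_posPart_add_posPart (le_of_eq ?_))
        (inf_add_eq_zero hw' (posPart_nonneg _) (posPart_nonneg _) h₁ hlow')
      simp only [map_sub]
      push_cast
      module
    · have h₁ := inf_eq_zero_of_le hw' (posPart_nonneg _) hww le_rfl hup
      refine inf_eq_zero_of_le hw' (posPart_nonneg _) le_rfl
        (posPart_le_posPart_add_posPart (le_of_eq ?_))
        (inf_add_eq_zero hw' (posPart_nonneg _) (posPart_nonneg _) h₁ hup')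
      simp only [map_sub]
      push_cast
      module

/-- If a positive projection on a nonzero Dedekind complete vector lattice has diagonal part
`α • 1` with `α > 0`, then `α` is the reciprocal of a positive integer. -/
theorem exists_nat_eq_one_div_of_diagonal (hP : IsPositiveOperator P)
    (hPP : ∀ z, P (P z) = P z) (hα : 0 < α) (hle : ∀ z, 0 ≤ z → α • z ≤ P z)
    (hinf : ∀ z, 0 ≤ z → ∀ w, (∀ a b, 0 ≤ a → 0 ≤ b → a + b = z → w ≤ P a - α • a + b) → w ≤ 0)
    {z : Z} (hz : 0 ≤ z) (hz0 : z ≠ 0) : ∃ n : ℕ, 1 ≤ n ∧ α = 1 / (n : ℝ) := by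
  by_contra! hcon
  set n := ⌊1 / α⌋₊ with hn
  have hn₁ : n * α ≤ 1 := by
    rw [← le_div_iff₀ hα]
    exact Nat.floor_le (by positivity)
  have hn₂ : 1 < (n + 1 : ℝ) * α := by
    rw [← div_lt_iff₀ hα]
    exact Nat.lt_floor_add_one _
  have hn₃ : n * α < 1 := by
    refine lt_of_le_of_ne hn₁ fun h => ?_
    have hn0 : n ≠ 0 := by rintro h0; simp [h0] at h
    refine hcon n (Nat.one_le_iff_ne_zero.2 hn0) ?_
    rw [eq_div_iff (by exact_mod_cast hn0), mul_comm, h]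
  obtain ⟨β, hβ, hnβ⟩ : ∃ β, α < β ∧ n * β < 1 := by
    -- For `n = 0`, that is `α > 1`, any `β > α` will do.
    rcases Nat.eq_zero_or_pos n with h0 | h0
    · exact ⟨α + 1, by linarith, by simp [h0]⟩
    · have h0' : (0 : ℝ) < n := by exact_mod_cast h0
      obtain ⟨β, h₁, h₂⟩ := exists_between ((lt_div_iff₀' h0').2 hn₃)
      exact ⟨β, h₁, (lt_div_iff₀' h0').1 h₂⟩
  have hu : 0 ≤ P z := hP z hz
  obtain ⟨r, w, hr, hru, -, hw, hwu, hw0, -, hlow, -⟩ :=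
    exists_component_map_between_nat hP hPP hα hle hinf hβ (hPP z) hu
      (fun h => hz0 (eq_zero_of_smul_le_map hα hle hz h)) hnβ (n + 1) le_rfl
  -- On `w`, `(n + 1) α P z ≤ P z - P r ≤ P z`, so `w` is disjoint from `P z`, although `0 ≠ w ≤ P
  -- z`.
  have hγ : 0 < (n + 1 : ℝ) * α - 1 := by linarith
  have h₁ : w ⊓ ((n + 1 : ℝ) * α - 1) • P z = 0 := by
    refine inf_eq_zero_of_le hw (smul_nonneg hγ.le hu) le_rfl (le_trans ?_ (le_posPart _)) hlow
    rw [← sub_nonneg]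
    refine (hP r hr).trans (le_of_eq ?_)
    rw [map_sub, hPP]
    push_cast
    module
  have h₂ := inf_smul_eq_zero hw (smul_nonneg hγ.le hu) h₁ (inv_pos.2 hγ).le
  rw [inv_smul_smul₀ hγ.ne', inf_eq_left.2 hwu] at h₂
  exact hw0 h₂

end PositiveProjection

/-! ### Reduction to the fixed space of an idempotent operator. -/

section FixedSpace

variable {X : Type*} [ConditionallyCompleteLattice X] [AddCommGroup X] [IsOrderedAddMonoid X]
  [Module ℝ X] [IsOrderedModule ℝ X]

/-- The fixed space of a positive idempotent operator on a Dedekind complete vector lattice is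
conditionally complete for the inherited order: the supremum in it is the image of the supremum in
the whole space. -/
noncomputable abbrev IsPositiveOperator.conditionallyCompleteLatticeRange {E : Module.End ℝ X}
    (hE : IsPositiveOperator E) (hEE : ∀ x, E (E x) = E x) :
    ConditionallyCompleteLattice (LinearMap.range E) :=
  have hfix : ∀ x : LinearMap.range E, E x = x := by
    rintro ⟨_, y, rfl⟩
    exact hEE y
  { (inferInstance : PartialOrder (LinearMap.range E)) with
    sup := fun x y => ⟨E (x ⊔ y), _, rfl⟩
    le_sup_left := fun x y => by
      change (x : X) ≤ E (x ⊔ y)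
      exact (hfix x).symm.le.trans (hE.mono le_sup_left)
    le_sup_right := fun x y => by
      change (y : X) ≤ E (x ⊔ y)
      exact (hfix y).symm.le.trans (hE.mono le_sup_right)
    sup_le := fun x y z hx hy => by
      change E ((x : X) ⊔ y) ≤ z
      exact (hE.mono (sup_le hx hy)).trans (hfix z).le
    inf := fun x y => ⟨E (x ⊓ y), _, rfl⟩
    inf_le_left := fun x y => by
      change E ((x : X) ⊓ y) ≤ x
      exact (hE.mono inf_le_left).trans (hfix x).le
    inf_le_right := fun x y => by
      change E ((x : X) ⊓ y) ≤ y
      exact (hE.mono inf_le_right).trans (hfix y).le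
    le_inf := fun x y z hx hy => by
      change (x : X) ≤ E (y ⊓ z)
      exact (hfix x).symm.le.trans (hE.mono (le_inf hx hy))
    sSup := fun S => ⟨E (sSup (Subtype.val '' S)), _, rfl⟩
    sInf := fun S => ⟨E (sInf (Subtype.val '' S)), _, rfl⟩
    isLUB_csSup := fun S hne hbdd => by
      obtain ⟨b, hb⟩ := hbdd
      refine ⟨fun x hx => ?_, fun z hz => ?_⟩
      · change (x : X) ≤ E (sSup (Subtype.val '' S))
        refine (hfix x).symm.le.trans (hE.mono (le_csSup ⟨b, ?_⟩ ⟨x, hx, rfl⟩))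
        rintro _ ⟨y, hy, rfl⟩
        exact hb hy
      · change E (sSup (Subtype.val '' S)) ≤ z
        refine (hE.mono (csSup_le (hne.image _) ?_)).trans (hfix z).le
        rintro _ ⟨y, hy, rfl⟩
        exact hz hy
    isGLB_csInf := fun S hne hbdd => by
      obtain ⟨b, hb⟩ := hbdd
      refine ⟨fun x hx => ?_, fun z hz => ?_⟩
      · change E (sInf (Subtype.val '' S)) ≤ x
        have hbdd : BddBelow (Subtype.val '' S) := ⟨(b : X), ?_⟩
        · exact (hE.mono (csInf_le hbdd ⟨x, hx, rfl⟩)).trans (hfix x).le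
        rintro _ ⟨y, hy, rfl⟩
        exact hb hy
      · change (z : X) ≤ E (sInf (Subtype.val '' S))
        refine (hfix z).symm.le.trans (hE.mono (le_csInf (hne.image _) ?_))
        rintro _ ⟨y, hy, rfl⟩
        exact hz hy }

namespace RegularOperator

/-- The Riesz–Kantorovich formula for disjoint operators. -/
theorem le_zero_of_inf_eq_zero {S T : RegularOperator X} (h : S ⊓ T = 0) {x w : X} (hx : 0 ≤ x)
    (hw : ∀ a b, 0 ≤ a → 0 ≤ b → a + b = x → w ≤ S.1 a + T.1 b) : w ≤ 0 := by
  -- Disjointness means `S = (S - T)⁺`, so `S x` is a supremum of values `S y - T y`, each at most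
  -- `S x - w`.
  have h₁ : S - pos (S - T) = 0 := h
  have h₂ : S.1 x ≤ S.1 x - w := by
    conv_lhs => rw [sub_eq_zero.1 h₁, pos_apply _ hx]
    refine posAux_le (S - T) hx fun y hy hyx => ?_
    have h₃ := hw (x - y) y (sub_nonneg.2 hyx) hy (sub_add_cancel x y)
    rw [map_sub] at h₃
    change S.1 y - T.1 y ≤ _
    rw [← sub_nonneg] at h₃ ⊢
    refine h₃.trans (le_of_eq ?_)
    abel
  simpa using h₂

/-- If `P = α E + Y` with `P` and `E ≠ 0` positive idempotents, `E P = P E = P` and `Y` disjoint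
from `E`, then `α` is zero or the reciprocal of a positive integer. -/
theorem exists_nat_eq_one_div {E P Y : RegularOperator X} {α : ℝ} (hE : 0 ≤ E) (hE0 : E ≠ 0)
    (hEE : E * E = E) (hPP : P * P = P) (hEP : E * P = P) (hPE : P * E = P) (hα : 0 < α)
    (hdecomp : P = α • E + Y) (hdisj : Y ⊓ E = 0) : ∃ n : ℕ, 1 ≤ n ∧ α = 1 / (n : ℝ) := by
  have hY : 0 ≤ Y := hdisj.symm.le.trans inf_le_left
  have hEpos : IsPositiveOperator E.1 := fun x hx => hE x hx
  have mul_val : ∀ {S T U : RegularOperator X}, S * T = U → ∀ x, S.1 (T.1 x) = U.1 x := by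
    rintro S T _ rfl x
    rfl
  have hPval : ∀ x, P.1 x = α • E.1 x + Y.1 x := fun x => by rw [hdecomp]; rfl
  let := hEpos.conditionallyCompleteLatticeRange (mul_val hEE)
  have hfix : ∀ x : LinearMap.range E.1, E.1 x = x := by
    rintro ⟨_, y, rfl⟩
    exact mul_val hEE y
  have : IsOrderedAddMonoid (LinearMap.range E.1) :=
    ⟨fun a b h c => add_le_add_left (α := X) h c, fun a b h c => add_le_add_right (α := X) h c⟩
  have : IsOrderedModule ℝ (LinearMap.range E.1) :=
    { smul_le_smul_of_nonneg_left := fun c hc a b h =>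
        smul_le_smul_of_nonneg_left (β := X) h hc
      smul_le_smul_of_nonneg_right := fun a ha c d h =>
        smul_le_smul_of_nonneg_right (β := X) h ha }
  let Q : Module.End ℝ (LinearMap.range E.1) :=
    (P.1.codRestrict (LinearMap.range E.1) fun x => ⟨P.1 x, mul_val hEP x⟩).comp
      (LinearMap.range E.1).subtype
  obtain ⟨x, hx, hEx⟩ : ∃ x, 0 ≤ x ∧ E.1 x ≠ 0 := by
    by_contra! hcon
    exact hE0 (le_antisymm (fun x hx => (hcon x hx).le) hE)
  refine exists_nat_eq_one_div_of_diagonal (P := Q) (z := ⟨E.1 x, x, rfl⟩) ?_ ?_ hα ?_ ?_ ?_ ?_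
  · intro z hz
    change 0 ≤ P.1 z
    rw [hPval]
    exact add_nonneg (smul_nonneg hα.le (hE _ hz)) (hY _ hz)
  · exact fun z => Subtype.ext (mul_val hPP z)
  · intro z hz
    change α • (z : X) ≤ P.1 z
    rw [hPval, hfix]
    exact le_add_of_nonneg_right (hY _ hz)
  · intro z hz w hw
    refine le_zero_of_inf_eq_zero hdisj (x := (z : X)) hz fun a b ha hb hab => ?_
    -- `E` carries a splitting of `z` in `X` to one in the fixed space, and `P E = P` identifies `P
    -- (E a) - α E a` with `Y a`.
    have h₁ := hw ⟨E.1 a, a, rfl⟩ ⟨E.1 b, b, rfl⟩ (hE a ha) (hE b hb)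
      (Subtype.ext (by change E.1 a + E.1 b = z; rw [← map_add, hab, hfix]))
    change (w : X) ≤ P.1 (E.1 a) - α • E.1 a + E.1 b at h₁
    rwa [mul_val hPE, hPval, add_sub_cancel_left] at h₁
  · exact hE x hx
  · exact fun h => hEx (congrArg Subtype.val h)

end RegularOperator

end FixedSpace

/-! ### Transport through the representation. -/

theorem mainTheorem4 {A : Type*}
    -- `A` is a lattice-ordered algebra: a real vector lattice with a real (associative, not
    -- necessarily unital) algebra structure whose product preserves positivity
    [NonUnitalRing A] [Lattice A] [IsOrderedAddMonoid A]
    [Module ℝ A] [IsOrderedModule ℝ A] [IsScalarTower ℝ A A] [SMulCommClass ℝ A A]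
    (hmul : ∀ a b : A, 0 ≤ a → 0 ≤ b → 0 ≤ a * b)
    (e p x : A) (α : ℝ)
    (he : 0 ≤ e) (he0 : e ≠ 0) (hp : 0 ≤ p) (hp0 : p ≠ 0)
    (hee : e * e = e) (hpp : p * p = p)
    (hep : e * p = p) (hpe : p * e = p)
    (hα : 0 ≤ α) (hdecomp : p = α • e + x) (hdisj : x ⊓ e = 0)
    (hα' : α ∉ ({0} ∪ {r : ℝ | ∃ n : ℕ, 1 ≤ n ∧ r = 1 / (n : ℝ)} : Set ℝ))
    -- `X` is a Dedekind complete vector lattice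
    {X : Type*} [ConditionallyCompleteLattice X] [AddCommGroup X] [IsOrderedAddMonoid X]
    [Module ℝ X] [IsOrderedModule ℝ X] :
    ¬ ∃ Φ : A →ₙₐ[ℝ] RegularOperator X,
      (∀ a b : A, Φ (a ⊔ b) = Φ a ⊔ Φ b) ∧ (∀ a b : A, Φ (a ⊓ b) = Φ a ⊓ Φ b) ∧
        Function.Injective Φ := by

  rintro ⟨Φ, -, hΦ, hinj⟩
  have hne : α ≠ 0 := fun h => hα' (Or.inl h)
  refine hα' (Or.inr (RegularOperator.exists_nat_eq_one_div (E := Φ e) (P := Φ p) (Y := Φ x)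
    ?_ ?_ ?_ ?_ ?_ ?_ (lt_of_le_of_ne hα hne.symm) ?_ ?_))
  · have h := hΦ 0 e
    rw [inf_eq_left.2 he, map_zero] at h
    exact h.le.trans inf_le_right
  · exact fun h => he0 (hinj (h.trans (map_zero Φ).symm))
  · rw [← map_mul, hee]
  · rw [← map_mul, hpp]
  · rw [← map_mul, hep]
  · rw [← map_mul, hpe]
  · rw [hdecomp, map_add, map_smul]
  · rw [← hΦ, hdisj, map_zero]
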